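/- **Conventions.** A vocabulary $\tau$ is a set of predicates and function symbols of finite arity (individual constants are $0$-place function symbols); $\tau$-models are non-empty. Let $\mathrm{qf}(\tau)$ be the set of atomic formulas $P(x_0,\dots,x_{n-1})$, $x_0=x_1$, $x_0=F(x_1,\dots,x_n)$ with $P,F\in\tau$. *The game.* Let $M_1,M_2$ be $\tau$-models, $\theta$ a cardinal, $\alpha$ an ordinal. A *state* is a tuple $\mathbf s=(A^1,A^2,h^1,h^2,g,\beta,n)$ with $n<\omega$ such that $A^\ell\subseteq M_\ell$, $|A^\ell|\le\theta$, $\beta\le\alpha$, $h^\ell:A^\ell\to\omega$, $g$ is a partial one-to-one function from $M_1$ to $M_2$ (put $g^1=g$, $g^2=g^{-1}$) with $\mathrm{Dom}(g^\ell)\subseteq A^\ell$, $g$ preserves the formulas in $\mathrm{qf}(\tau)$ and their negations (including those without free variables), and $h^\ell(a)<n$ for $a\in\mathrm{Dom}(g^\ell)$. The game $\Game_{\mathrm{qf}(\tau),\theta,\alpha}[M_1,M_2]$ starts at $\mathbf s_0=(\emptyset,\emptyset,\emptyset,\emptyset,\emptyset,\alpha,0)$. In the $n$-th move, at $\mathbf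 s_n$, player AIS chooses $\beta_{n+1}<\beta_{\mathbf s_n}$, $\iota\in\{1,2\}$ and $A'$ with $A^\iota_{\mathbf s_n}\subseteq A'\subseteq M_\iota$, $|A'|\le\theta$; then player ISO chooses a state $\mathbf s_{n+1}$ with $n_{\mathbf s_{n+1}}=n+1$ and $\beta_{\mathbf s_{n+1}}=\beta_{n+1}$, whose $A^\ell,h^\ell,g$ extend those of $\mathbf s_n$, and such that $A^\iota_{\mathbf s_{n+1}}=A'$; $A^{3-\iota}_{\mathbf s_{n+1}}=A^{3-\iota}_{\mathbf s_n}\cup\mathrm{Dom}(g^{3-\iota}_{\mathbf s_{n+1}})$; $h^\iota_{\mathbf s_{n+1}}(a)\ge n+1$ for $a\in A'\setminus A^\iota_{\mathbf s_n}$; $\mathrm{Dom}(g^\iota_{\mathbf s_{n+1}})=\{a\in A^\iota_{\mathbf s_n}:h^\iota_{\mathbf s_n}(a)<n+1\}$. A player without a legal move loses; ISO also loses if $\mathbf s_0$ is not a state. Write $M_1\,\mathcal E^0_{\mathrm{qf}(\tau),\theta,\alpha}\,M_2$ when ISO has a winning strategy, and let $\mathcal E^1_{\mathrm{qf}(\tau),\theta,\alpha}$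 be the equivalence relation on the class of $\tau$-models generated by $\mathcal E^0_{\mathrm{qf}(\tau),\theta,\alpha}$. *The logic.* Let $\beth_0(\theta)=\theta$, $\beth_{\alpha+1}(\theta)=2^{\beth_\alpha(\theta)}$, with suprema at limits. A sentence $\psi$ of $\mathbb L^1_{\le\theta}(\tau)$ is given by $\tau_1\subseteq\tau$ with $|\tau_1|\le\theta$, an ordinal $\alpha<\theta^+$ and a sequence $\langle M_i:i<i(*)\rangle$ of $\tau_1$-models with $i(*)\le\beth_{\alpha+1}(\theta)$; $M\models\psi$ iff $M{\restriction}\tau_1$ is $\mathcal E^1_{\mathrm{qf}(\tau_1),\theta,\alpha}$-equivalent to some $M_i$. Let $\mathbb L^1_\kappa=\bigcup_{\theta<\kappa}\mathbb L^1_{\le\theta}$, and let $\mathrm{Th}_{\mathbb L^1_\kappa}(M)$ be the set of sentences of $\mathbb L^1_\kappa(\tau)$ true in $M$. *Sums and products.* $M_1\times M_2$ is the product with coordinatewise functions and relations. If all function symbols of $\tau$ are unary (in particular if there are none), $M_1+M_2$ is the model on the disjoint union of the universes in which each symbol is interpreted by the union of its two interpretations. **Theorem 3.11.** Let $\kappa=\beth_\kappa$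 and let $\tau$ be a vocabulary; all models are $\tau$-models. In the statements on sums assume that $\tau$ has no function symbols other than unary ones. (a) $\mathrm{Th}_{\mathbb L^1_\kappa}(M_1+M_2)$ is a function of $\mathrm{Th}_{\mathbb L^1_\kappa}(M_1)$ and $\mathrm{Th}_{\mathbb L^1_\kappa}(M_2)$; that is, if $\mathrm{Th}_{\mathbb L^1_\kappa}(M_\ell)=\mathrm{Th}_{\mathbb L^1_\kappa}(N_\ell)$ for $\ell=1,2$, then $\mathrm{Th}_{\mathbb L^1_\kappa}(M_1+M_2)=\mathrm{Th}_{\mathbb L^1_\kappa}(N_1+N_2)$. (b) $\mathrm{Th}_{\mathbb L^1_\kappa}(M_1\times M_2)$ is a function of $\mathrm{Th}_{\mathbb L^1_\kappa}(M_1)$ and $\mathrm{Th}_{\mathbb L^1_\kappa}(M_2)$; that is, if $\mathrm{Th}_{\mathbb L^1_\kappa}(M_\ell)=\mathrm{Th}_{\mathbb L^1_\kappa}(N_\ell)$ for $\ell=1,2$, then $\mathrm{Th}_{\mathbb L^1_\kappa}(M_1\times M_2)=\mathrm{Th}_{\mathbb L^1_\kappa}(N_1\times N_2)$. (c) Moreover,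 for all $\theta<\kappa$ and $\alpha<\theta^+$, (a) and (b) hold with the class $N/\mathcal E^1_{\mathrm{qf}(\tau),\theta,\alpha}$ in place of $\mathrm{Th}_{\mathbb L^1_\kappa}(N)$ throughout: if $M_\ell\,\mathcal E^1_{\mathrm{qf}(\tau),\theta,\alpha}\,N_\ell$ for $\ell=1,2$, then $(M_1+M_2)\,\mathcal E^1_{\mathrm{qf}(\tau),\theta,\alpha}\,(N_1+N_2)$ and $(M_1\times M_2)\,\mathcal E^1_{\mathrm{qf}(\tau),\theta,\alpha}\,(N_1\times N_2)$. -/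

import Mathlib

universe u

noncomputable section

namespace ShelahL1

open Cardinal
open scoped FirstOrder

/-! ### Vocabularies, models, sums and products -/

/-- A `τ`-model: a (nonempty) structure for the vocabulary `τ`, no axioms being imposed. -/
abbrev Model (τ : FirstOrder.Language.{u, u}) : Type (u + 1) :=
  FirstOrder.Language.Theory.ModelType.{u, u, u} (∅ : τ.Theory)

/-- A sub-vocabulary of `τ`. -/
structure SubVocabulary (τ : FirstOrder.Language.{u, u}) where
  funs : ∀ n, Set (τ.Functions n)
  rels : ∀ n, Set (τ.Relations n)

/-- A sub-vocabulary as a vocabulary in its own right. -/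
def SubVocabulary.toLanguage {τ : FirstOrder.Language.{u, u}} (σ : SubVocabulary τ) : FirstOrder.Language.{u, u} where
  Functions n := σ.funs n
  Relations n := σ.rels n

/-- The inclusion of a sub-vocabulary. -/
def SubVocabulary.incl {τ : FirstOrder.Language.{u, u}} (σ : SubVocabulary τ) : σ.toLanguage →ᴸ τ where
  onFunction _ f := f.1
  onRelation _ r := r.1

/-- The reduct `M ↾ σ` of a `τ`-model to a sub-vocabulary `σ`. -/
def reduct {τ : FirstOrder.Language.{u, u}} (M : Model τ) (σ : SubVocabulary τ) : Model σ.toLanguage where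
  Carrier := M
  struc := σ.incl.reduct M
  is_model := @FirstOrder.Language.model_empty _ _ (σ.incl.reduct M)

/-- All function symbols of `τ` are unary. Relational vocabularies are included. -/
def OnlyUnaryFunctions (τ : FirstOrder.Language.{u, u}) : Prop :=
  ∀ n, n ≠ 1 → IsEmpty (τ.Functions n)

/-- The structure on the disjoint union: every symbol is interpreted by the union of its two
interpretations. -/
@[reducible]
def sumStructure {τ : FirstOrder.Language.{u, u}} (hτ : OnlyUnaryFunctions τ) (M₁ M₂ : Model τ) :
    τ.Structure (M₁ ⊕ M₂) where
  funMap {n} f x :=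
    have hn : 0 < n := by
      by_contra h
      exact (hτ n (by omega)).false f
    Sum.map (fun a : M₁ => FirstOrder.Language.Structure.funMap f (fun _ => a))
      (fun b : M₂ => FirstOrder.Language.Structure.funMap f (fun _ => b)) (x ⟨0, hn⟩)
  RelMap {_} R x :=
    (∃ y, x = Sum.inl ∘ y ∧ FirstOrder.Language.Structure.RelMap (M := M₁) R y) ∨
      (∃ y, x = Sum.inr ∘ y ∧ FirstOrder.Language.Structure.RelMap (M := M₂) R y)

/-- The disjoint sum `M₁ + M₂`. -/
def sumModel {τ : FirstOrder.Language.{u, u}} (hτ : OnlyUnaryFunctions τ) (M₁ M₂ : Model τ) : Model τ where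
  Carrier := M₁ ⊕ M₂
  struc := sumStructure hτ M₁ M₂
  is_model := @FirstOrder.Language.model_empty _ _ (sumStructure hτ M₁ M₂)

/-- The coordinatewise structure on the cartesian product. -/
@[reducible]
def prodStructure {τ : FirstOrder.Language.{u, u}} (M₁ M₂ : Model τ) : τ.Structure (M₁ × M₂) where
  funMap f x :=
    (FirstOrder.Language.Structure.funMap f (fun i => (x i).1), FirstOrder.Language.Structure.funMap f (fun i => (x i).2))
  RelMap R x :=
    FirstOrder.Language.Structure.RelMap R (fun i => (x i).1) ∧ FirstOrder.Language.Structure.RelMap R (fun i => (x i).2)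

/-- The product `M₁ × M₂`. -/
def prodModel {τ : FirstOrder.Language.{u, u}} (M₁ M₂ : Model τ) : Model τ where
  Carrier := M₁ × M₂
  struc := prodStructure M₁ M₂
  is_model := @FirstOrder.Language.model_empty _ _ (prodStructure M₁ M₂)

/-! ### Sets of formulas -/

/-- Formulas `φ(x₀, …, xₙ₋₁)` with finitely many free variables. -/
abbrev FinFormula (τ : FirstOrder.Language.{u, u}) : Type u := Σ n : ℕ, τ.Formula (Fin n)

/-- The atomic formulas `P(x₀, …, xₙ₋₁)`, `x₀ = x₁` and `x₀ = F(x₁, …, xₙ)`. -/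
inductive IsAtomicFormula {τ : FirstOrder.Language.{u, u}} : FinFormula τ → Prop
  | rel {n : ℕ} (R : τ.Relations n) :
      IsAtomicFormula ⟨n, R.formula fun i => FirstOrder.Language.Term.var i⟩
  | eq : IsAtomicFormula ⟨2, (FirstOrder.Language.Term.var 0).equal (FirstOrder.Language.Term.var 1)⟩
  | func {n : ℕ} (F : τ.Functions n) :
      IsAtomicFormula
        ⟨n + 1, (FirstOrder.Language.Term.var 0).equal (FirstOrder.Language.Term.func F fun i => FirstOrder.Language.Term.var i.succ)⟩

/-- `qf(τ)`, taken to be the set of atomic formulas. -/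
def qf (τ : FirstOrder.Language.{u, u}) : Set (FinFormula τ) := {φ | IsAtomicFormula φ}

/-! ### The game `⅁_{Γ,θ,α}[M₁, M₂]`

The two models form a family `M : Bool → Model τ`, with `M false` for `M₁` and `M true` for `M₂`;
the index opposite to `ι` is `!ι`. -/

section Game

variable {τ : FirstOrder.Language.{u, u}}

/-- The data `(A¹, A², h¹, h², g, β, n)`. Only the values of `h ℓ` on `A ℓ` matter; `g` is given by
its graph, a set of pairs `p` with `p false ∈ M₁`, `p true ∈ M₂`. -/
structure Position (M : Bool → Model τ) where
  A : ∀ l, Set (M l)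
  h : ∀ l, M l → ℕ
  g : Set (∀ l, M l)
  β : Ordinal.{u}
  n : ℕ

/-- `Dom(g^ℓ)`: the domain of `g` for `ℓ = 1`, of its inverse for `ℓ = 2`. -/
def Position.dom {M : Bool → Model τ} (s : Position M) (l : Bool) : Set (M l) :=
  {a | ∃ p ∈ s.g, p l = a}

/-- `s` is a state of the game. -/
structure IsState (Γ : Set (FinFormula τ)) (θ : Cardinal.{u}) (α : Ordinal.{u})
    {M : Bool → Model τ} (s : Position M) : Prop where
  card_le : ∀ l, #(s.A l) ≤ θ
  ordinal_le : s.β ≤ α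
  /-- `g` is the graph of a partial one-to-one function -/
  one_to_one : ∀ l, ∀ p ∈ s.g, ∀ q ∈ s.g, p l = q l → p = q
  dom_subset : ∀ l, s.dom l ⊆ s.A l
  preserves : ∀ φ ∈ Γ, ∀ x : Fin φ.1 → ∀ l, M l, (∀ i, x i ∈ s.g) →
    (φ.2.Realize (fun i => x i false) ↔ φ.2.Realize (fun i => x i true))
  lt_of_dom : ∀ l, ∀ a ∈ s.dom l, s.h l a < s.n

/-- The initial position. -/
def initial (M : Bool → Model τ) (α : Ordinal.{u}) : Position M where
  A _ := ∅
  h _ _ := 0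
  g := ∅
  β := α
  n := 0

/-- `t` extends `s`. -/
structure Extends {M : Bool → Model τ} (s t : Position M) : Prop where
  A_subset : ∀ l, s.A l ⊆ t.A l
  h_eq : ∀ l, ∀ a ∈ s.A l, t.h l a = s.h l a
  g_subset : s.g ⊆ t.g
  β_lt : t.β < s.β
  n_lt : s.n < t.n

/-- `t` is a successor of `s`. -/
def IsSuccessor {M : Bool → Model τ} (s t : Position M) : Prop :=
  Extends s t ∧ t.n = s.n + 1

/-- A move `(β, ι, A')` of the anti-isomorphism player AIS. -/
structure AisMove (M : Bool → Model τ) where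
  β : Ordinal.{u}
  ι : Bool
  A' : Set (M ι)

/-- The move `m` of AIS is legal at `s`. -/
def AisLegal (θ : Cardinal.{u}) {M : Bool → Model τ} (s : Position M) (m : AisMove M) : Prop :=
  m.β < s.β ∧ s.A m.ι ⊆ m.A' ∧ #m.A' ≤ θ

/-- `t` is a legal answer of the isomorphism player ISO at `s` to the move `m` of AIS. -/
structure IsoLegal (Γ : Set (FinFormula τ)) (θ : Cardinal.{u}) (α : Ordinal.{u})
    {M : Bool → Model τ} (s : Position M) (m : AisMove M) (t : Position M) : Prop where
  isState : IsState Γ θ α t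
  isSuccessor : IsSuccessor s t
  A_eq : t.A m.ι = m.A'
  A_other : t.A (!m.ι) = s.A (!m.ι) ∪ t.dom (!m.ι)
  le_h : ∀ a ∈ m.A' \ s.A m.ι, s.n + 1 ≤ t.h m.ι a
  dom_eq : t.dom m.ι = {a ∈ s.A m.ι | s.h m.ι a < s.n + 1}
  β_eq : t.β = m.β

/-- A strategy of ISO: the state reached, as a function of the list of the moves that AIS has made
so far (the latest one first). -/
abbrev Strategy (M : Bool → Model τ) := List (AisMove M) → Position M

/-- The list of moves of AIS is a legal partial play against `S`. -/
def IsPlay (θ : Cardinal.{u}) {M : Bool → Model τ} (S : Strategy M) : List (AisMove M) → Prop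
  | [] => True
  | m :: ms => IsPlay θ S ms ∧ AisLegal θ (S ms) m

/-- `S` is winning for ISO: the initial position is a state, and in every play in which ISO follows
`S` he answers each legal move legally. As the ordinals decrease, every play is finite, so it is
then AIS who is left without a legal move. -/
structure Strategy.IsWinning (Γ : Set (FinFormula τ)) (θ : Cardinal.{u}) (α : Ordinal.{u})
    {M : Bool → Model τ} (S : Strategy M) : Prop where
  start : S [] = initial M α
  isState : IsState Γ θ α (initial M α)
  legal : ∀ ms m, IsPlay θ S ms → AisLegal θ (S ms) m → IsoLegal Γ θ α (S ms) m (S (m :: ms))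

/-- The pair `(M₁, M₂)` as a family indexed by `Bool`. -/
def pair (M₁ M₂ : Model τ) : Bool → Model τ
  | false => M₁
  | true => M₂

/-- `M₁ 𝓔⁰_{Γ,θ,α} M₂`: ISO has a winning strategy. -/
def E0 (Γ : Set (FinFormula τ)) (θ : Cardinal.{u}) (α : Ordinal.{u}) (M₁ M₂ : Model τ) : Prop :=
  ∃ S : Strategy (pair M₁ M₂), S.IsWinning Γ θ α

/-- `𝓔¹_{Γ,θ,α}`: the equivalence relation on the class of `τ`-models generated by `𝓔⁰_{Γ,θ,α}`. -/
def E1 (Γ : Set (FinFormula τ)) (θ : Cardinal.{u}) (α : Ordinal.{u}) : Setoid (Model τ) :=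
  Relation.EqvGen.setoid (E0 Γ θ α)

/-- The class `M / 𝓔¹_{qf(τ),θ,α}`. -/
def classE1 (θ : Cardinal.{u}) (α : Ordinal.{u}) (M : Model τ) : Quotient (E1 (qf τ) θ α) :=
  Quotient.mk _ M

end Game

/-! ### The logic `𝕃¹_κ` -/

/-- `ℶ_α(θ)`: `ℶ_0(θ) = θ`, `ℶ_{α+1}(θ) = 2 ^ ℶ_α(θ)`, with suprema at limits. -/
def bethOver (θ : Cardinal.{u}) (α : Ordinal.{u}) : Cardinal.{u} :=
  Ordinal.limitRecOn α θ (fun _ c => 2 ^ c) (fun o _ ih => ⨆ b : Set.Iio o, ih b.1 b.2)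

/-- A sentence of `𝕃¹_{≤θ}(τ)`, defined by a triple `(qf(τ₁), θ, α)` and a sequence of at most
`ℶ_{α+1}(θ)` many `τ₁`-models. -/
structure SentenceLE (τ : FirstOrder.Language.{u, u}) (θ : Cardinal.{u}) where
  τ₁ : SubVocabulary τ
  card_le : τ₁.toLanguage.card ≤ θ
  α : Ordinal.{u}
  α_lt : α < (Order.succ θ).ord
  Idx : Type u
  card_Idx : #Idx ≤ bethOver θ (α + 1)
  models : Idx → Model τ₁.toLanguage

/-- `M ⊨ ψ`: the reduct of `M` is `𝓔¹_{qf(τ₁),θ,α}`-equivalent to a model of the sequence. -/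
def SentenceLE.Sat {τ : FirstOrder.Language.{u, u}} {θ : Cardinal.{u}} (ψ : SentenceLE τ θ) (M : Model τ) :
    Prop :=
  ∃ i, E1 (qf ψ.τ₁.toLanguage) θ ψ.α (reduct M ψ.τ₁) (ψ.models i)

/-- `𝕃¹_κ(τ)`, the union of the `𝕃¹_{≤θ}(τ)` for `θ < κ`. -/
abbrev SentenceK (κ : Cardinal.{u}) (τ : FirstOrder.Language.{u, u}) : Type (u + 1) :=
  Σ θ : Set.Iio κ, SentenceLE τ θ.1

/-- The `𝕃¹_κ`-theory of `M`. -/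
def Th (κ : Cardinal.{u}) {τ : FirstOrder.Language.{u, u}} (M : Model τ) : Set (SentenceK κ τ) :=
  {ψ | ψ.2.Sat M}

end ShelahL1

end

open ShelahL1

noncomputable section

namespace ShelahL1

open Cardinal FirstOrder FirstOrder.Language

variable {τ : FirstOrder.Language.{u, u}}

/-! ### Safe sets of positions -/

/-! A theory determines, and is determined by, the `E1`-classes of all reducts to at most `θ`
symbols, at all levels `θ < κ`, `α < θ⁺`: a sentence may list a single model, so the class of any
given reduct is itself definable (`Th_eq_iff`). Reducts commute with sums and products, so
everything follows once `E1` is a congruence for both operations. Since `E1` is generated by `E0`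
and `E0` is reflexive (`E0_refl`), it is enough that `E0` is a congruence (`eqvGen_congr₂`,
`E0_sum`, `E0_prod`).

For infinite `θ`, ISO plays the games on the two components side by side. In a sum the position is
literally the disjoint union of two positions (`isoLegal_sumPosition`). In a product the partial
isomorphism is the coordinatewise one, cut down to the domain that the rules prescribe, and heights
are kept comparable to the maximum of the coordinate heights (`ProdInv.step`).

For finite `θ` the combined sets may have more than `θ` elements. But then `α` is finite, and ISO
wins without ever matching an element, provided the 0-place predicates agree (`isoWins_of_finite`).
-/

/-- A set of positions from which ISO can always answer while staying in the set. -/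
def IsSafe (Γ : Set (FinFormula τ)) (θ : Cardinal.{u}) (α : Ordinal.{u}) {M : Bool → Model τ}
    (W : Set (Position M)) : Prop :=
  ∀ s ∈ W, ∀ m, AisLegal θ s m → ∃ t ∈ W, IsoLegal Γ θ α s m t

/-- ISO wins the game on the family `M`. -/
def IsoWins (Γ : Set (FinFormula τ)) (θ : Cardinal.{u}) (α : Ordinal.{u})
    (M : Bool → Model τ) : Prop :=
  IsState Γ θ α (initial M α) ∧ ∃ W : Set (Position M), initial M α ∈ W ∧ IsSafe Γ θ α W

open Classical in
/-- The strategy of ISO that stays in the set `W` whenever possible. -/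
def stayIn (Γ : Set (FinFormula τ)) (θ : Cardinal.{u}) (α : Ordinal.{u}) {M : Bool → Model τ}
    (W : Set (Position M)) : Strategy M
  | [] => initial M α
  | m :: ms =>
    -- The default is never reached in a legal play when `W` is safe and contains the initial
    -- position.
    if h : ∃ t ∈ W, IsoLegal Γ θ α (stayIn Γ θ α W ms) m t then h.choose else initial M α

theorem stayIn_cons {Γ : Set (FinFormula τ)} {θ : Cardinal.{u}} {α : Ordinal.{u}}
    {M : Bool → Model τ} {W : Set (Position M)} (hW : IsSafe Γ θ α W) {m : AisMove M}
    {ms : List (AisMove M)} (hs : stayIn Γ θ α W ms ∈ W) (hm : AisLegal θ (stayIn Γ θ α W ms) m) :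
    stayIn Γ θ α W (m :: ms) ∈ W ∧
      IsoLegal Γ θ α (stayIn Γ θ α W ms) m (stayIn Γ θ α W (m :: ms)) := by
  have h := hW _ hs m hm
  rw [stayIn, dif_pos h]
  exact h.choose_spec

theorem stayIn_mem {Γ : Set (FinFormula τ)} {θ : Cardinal.{u}} {α : Ordinal.{u}}
    {M : Bool → Model τ} {W : Set (Position M)} (hW : IsSafe Γ θ α W) (h0 : initial M α ∈ W) :
    ∀ ms, IsPlay θ (stayIn Γ θ α W) ms → stayIn Γ θ α W ms ∈ W
  | [], _ => h0
  | _ :: ms, h => (stayIn_cons hW (stayIn_mem hW h0 ms h.1) h.2).1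

/-- The positions reached by a winning strategy form a safe set; conversely, choosing answers inside
a safe set is a strategy. In this form strategies are combined through invariants on positions,
without tracking histories. -/
theorem E0_iff_isoWins {Γ : Set (FinFormula τ)} {θ : Cardinal.{u}} {α : Ordinal.{u}}
    {M₁ M₂ : Model τ} : E0 Γ θ α M₁ M₂ ↔ IsoWins Γ θ α (pair M₁ M₂) := by
  constructor
  · rintro ⟨S, hS⟩
    refine ⟨hS.isState, {s | ∃ ms, IsPlay θ S ms ∧ S ms = s}, ⟨[], trivial, hS.start⟩, ?_⟩
    rintro _ ⟨ms, hms, rfl⟩ m hm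
    exact ⟨_, ⟨m :: ms, ⟨hms, hm⟩, rfl⟩, hS.legal ms m hms hm⟩
  · rintro ⟨h, W, h0, hW⟩
    exact ⟨stayIn Γ θ α W, rfl, h,
      fun ms m hms hm => (stayIn_cons hW (stayIn_mem hW h0 ms hms) hm).2⟩

/-! ### Preservation of atomic formulas -/

/-- The pairs in `g` preserve the atomic formulas and their negations. -/
structure PreservesAtomic {M : Bool → Model τ} (g : Set (∀ l, M l)) : Prop where
  rel : ∀ {n} (R : τ.Relations n) (x : Fin n → ∀ l, M l), (∀ i, x i ∈ g) →
    (Structure.RelMap R (fun i => x i false) ↔ Structure.RelMap R (fun i => x i true))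
  eq : ∀ p ∈ g, ∀ q ∈ g, p false = q false ↔ p true = q true
  func : ∀ {n} (F : τ.Functions n) (p : ∀ l, M l) (x : Fin n → ∀ l, M l), p ∈ g → (∀ i, x i ∈ g) →
    (p false = Structure.funMap F (fun i => x i false) ↔
      p true = Structure.funMap F (fun i => x i true))

theorem preserves_qf_iff {M : Bool → Model τ} {g : Set (∀ l, M l)} :
    (∀ φ ∈ qf τ, ∀ x : Fin φ.1 → ∀ l, M l, (∀ i, x i ∈ g) →
      (φ.2.Realize (fun i => x i false) ↔ φ.2.Realize (fun i => x i true))) ↔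
      PreservesAtomic g := by
  constructor
  · intro h
    refine ⟨fun R x hx => ?_, fun p hp q hq => ?_, fun F p x hp hx => ?_⟩
    · simpa [Formula.realize_rel] using h _ (IsAtomicFormula.rel R) x hx
    · simpa [Formula.realize_equal] using h _ IsAtomicFormula.eq ![p, q] (by
        intro i
        fin_cases i
        exacts [hp, hq])
    · simpa [Formula.realize_equal] using h _ (IsAtomicFormula.func F) (Fin.cons p x) (by
        intro i
        refine Fin.cases ?_ (fun i => ?_) i
        exacts [hp, hx i])
  · rintro h _ (R | _ | F) x hx
    · simpa [Formula.realize_rel] using h.rel R x hx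
    · simpa [Formula.realize_equal] using h.eq _ (hx 0) _ (hx 1)
    · simpa [Formula.realize_equal] using
        h.func F (x 0) (fun i => x i.succ) (hx 0) (fun i => hx i.succ)

theorem PreservesAtomic.mono {M : Bool → Model τ} {g g' : Set (∀ l, M l)} (h : PreservesAtomic g')
    (hg : g ⊆ g') : PreservesAtomic g :=
  ⟨fun R x hx => h.rel R x fun i => hg (hx i), fun p hp q hq => h.eq p (hg hp) q (hg hq),
    fun F p x hp hx => h.func F p x (hg hp) fun i => hg (hx i)⟩

/-- With no pairs available only the 0-place predicates are tested: the other atomic formulas have a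
free variable. -/
theorem isState_initial_iff {θ : Cardinal.{u}} {α : Ordinal.{u}} {M : Bool → Model τ} :
    IsState (qf τ) θ α (initial M α) ↔ PreservesAtomic (∅ : Set (∀ l, M l)) := by
  refine ⟨fun h => preserves_qf_iff.1 h.preserves, fun h => ?_⟩
  refine ⟨fun l => ?_, le_rfl, ?_, ?_, preserves_qf_iff.2 h, ?_⟩ <;>
    simp [initial, Position.dom]

/-! ### Games of finite length -/

/-- In a game of finite length ISO may postpone everything beyond the end. -/
theorem isoWins_of_finite {θ : Cardinal.{u}} {M : Bool → Model τ} (k : ℕ)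
    (h : PreservesAtomic (∅ : Set (∀ l, M l))) : IsoWins (qf τ) θ k M := by
  -- The ordinal drops and the counter grows by one at each move, so `b + s.n ≤ k` persists and the
  -- counter never passes `k`. Heights above `k` therefore keep the prescribed domain of `g` empty.
  refine ⟨isState_initial_iff.2 h, {s | IsState (qf τ) θ k s ∧ s.g = ∅ ∧
    (∀ l, ∀ a ∈ s.A l, k < s.h l a) ∧ ∃ b : ℕ, s.β = b ∧ b + s.n ≤ k}, ?_, ?_⟩
  · exact ⟨isState_initial_iff.2 h, rfl, fun l a ha => ha.elim, k, rfl, le_rfl⟩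
  rintro s ⟨hs, hg, hh, b, hb, hbk⟩ ⟨β, ι, A'⟩ ⟨hβ, hA, hc⟩
  dsimp only at hβ hA hc
  obtain ⟨c, rfl⟩ := Ordinal.lt_omega0.1 (hβ.trans (hb ▸ Ordinal.natCast_lt_omega0 b))
  have hcb : c < b := by rw [hb] at hβ; exact_mod_cast hβ
  classical
  let t : Position M :=
    { A := Function.update s.A ι A'
      h := fun l a => if a ∈ s.A l then s.h l a else k + 1
      g := ∅
      β := c
      n := s.n + 1 }
  have hdom : ∀ l, t.dom l = ∅ := fun l => by simp [Position.dom, t]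
  have ht : IsState (qf τ) θ k t := by
    refine ⟨fun l => ?_, ?_, by simp [t], fun l => by simp [hdom], preserves_qf_iff.2 h,
      fun l => by simp [hdom]⟩
    · rcases eq_or_ne l ι with rfl | hl
      · simpa [t] using hc
      · simpa [t, hl] using hs.card_le l
    · exact hβ.le.trans hs.ordinal_le
  have hsub : ∀ l, s.A l ⊆ t.A l := fun l => by
    rcases eq_or_ne l ι with rfl | hl
    · simpa [t] using hA
    · simp [t, hl]
  refine ⟨t, ⟨ht, rfl, fun l a _ => ?_, c, rfl, ?_⟩, ht, ⟨⟨hsub, ?_, ?_, hβ, ?_⟩, rfl⟩, ?_, ?_, ?_,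
    ?_, rfl⟩
  · by_cases ha : a ∈ s.A l
    · simpa [t, ha] using hh l a ha
    · simp [t, ha]
  · change c + (s.n + 1) ≤ k
    omega
  · intro l a ha
    simp [t, ha]
  · simp [hg]
  · simp [t]
  · simp [t]
  · rw [hdom]
    simp [t]
  · rintro a ⟨_, ha⟩
    simp only [t, ha, if_false]
    omega
  · rw [hdom]
    symm
    ext a
    simp only [Set.mem_ofPred_eq, Set.mem_empty_iff_false, iff_false, not_and, not_lt]
    intro ha
    have : k < s.h ι a := hh _ a ha
    omega

/-! ### Products -/

/-- An atomic formula holds in a product exactly when it holds in both coordinates. -/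
theorem PreservesAtomic.prod {M N : Bool → Model τ} {g₁ : Set (∀ l, M l)} {g₂ : Set (∀ l, N l)}
    (h₁ : PreservesAtomic g₁) (h₂ : PreservesAtomic g₂) :
    PreservesAtomic (M := fun l => prodModel (M l) (N l))
      {p | (fun l => (p l).1) ∈ g₁ ∧ (fun l => (p l).2) ∈ g₂} where
  rel R x hx := and_congr (h₁.rel R (fun i l => (x i l).1) fun i => (hx i).1)
    (h₂.rel R (fun i l => (x i l).2) fun i => (hx i).2)
  eq _ hp _ hq := Prod.ext_iff.trans <| (and_congr (h₁.eq _ hp.1 _ hq.1)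
    (h₂.eq _ hp.2 _ hq.2)).trans Prod.ext_iff.symm
  func F p x hp hx := Prod.ext_iff.trans <|
    (and_congr (h₁.func F _ (fun i l => (x i l).1) hp.1 fun i => (hx i).1)
      (h₂.func F _ (fun i l => (x i l).2) hp.2 fun i => (hx i).2)).trans
    (@Prod.ext_iff (M true) (N true) (p true)
      (Structure.funMap F (fun i => (x i true).1), Structure.funMap F fun i => (x i true).2)).symm

/-- A position of the product game that is controlled by positions of the games on the factors. -/
structure ProdInv (θ : Cardinal.{u}) (α : Ordinal.{u}) {M N : Bool → Model τ}
    (s : Position fun l => prodModel (M l) (N l)) (s₁ : Position M) (s₂ : Position N) : Prop where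
  isState : IsState (qf τ) θ α s
  isState_fst : IsState (qf τ) θ α s₁
  isState_snd : IsState (qf τ) θ α s₂
  β_fst : s₁.β = s.β
  β_snd : s₂.β = s.β
  n_fst : s₁.n = s.n
  n_snd : s₂.n = s.n
  A_fst : ∀ l, ∀ a ∈ s.A l, a.1 ∈ s₁.A l
  A_snd : ∀ l, ∀ a ∈ s.A l, a.2 ∈ s₂.A l
  h_fst : ∀ l, ∀ a ∈ s.A l, s₁.h l a.1 ≤ s.h l a
  h_snd : ∀ l, ∀ a ∈ s.A l, s₂.h l a.2 ≤ s.h l a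
  h_le : ∀ l, ∀ a ∈ s.A l, s.h l a ≤ max (max (s₁.h l a.1) (s₂.h l a.2)) s.n
  g_fst : ∀ p ∈ s.g, (fun l => (p l).1) ∈ s₁.g
  g_snd : ∀ p ∈ s.g, (fun l => (p l).2) ∈ s₂.g

/-- The rules fix the domain of `g` on the side `ι` through the heights. The bounds `h_fst` and
`h_snd` ensure that an element due in the product has both coordinates due in the factors.
Conversely `h_le` ensures that an element with both coordinates matched has height below the new
counter. -/
theorem ProdInv.step {θ : Cardinal.{u}} {α : Ordinal.{u}} {M N : Bool → Model τ} (hθ : ℵ₀ ≤ θ)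
    {s : Position fun l => prodModel (M l) (N l)} {s₁ : Position M} {s₂ : Position N}
    (I : ProdInv θ α s s₁ s₂) {β : Ordinal.{u}} {ι : Bool} {A' : Set (prodModel (M ι) (N ι))}
    (hβ : β < s.β) (hA : s.A ι ⊆ A') {t₁ : Position M} {t₂ : Position N}
    (h₁ : IsoLegal (qf τ) θ α s₁ ⟨β, ι, s₁.A ι ∪ Prod.fst '' A'⟩ t₁)
    (h₂ : IsoLegal (qf τ) θ α s₂ ⟨β, ι, s₂.A ι ∪ Prod.snd '' A'⟩ t₂) :
    ∃ t, ProdInv θ α t t₁ t₂ ∧ IsoLegal (qf τ) θ α s ⟨β, ι, A'⟩ t := by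
  classical
  -- The full product of `t₁.g` and `t₂.g` may have too large a domain, so it is restricted on the
  -- side `ι` to the elements that are due.
  let g : Set (∀ l, prodModel (M l) (N l)) := {p | p ι ∈ s.A ι ∧ s.h ι (p ι) < s.n + 1 ∧
    (fun l => (p l).1) ∈ t₁.g ∧ (fun l => (p l).2) ∈ t₂.g}
  let t : Position fun l => prodModel (M l) (N l) :=
    { A := Function.update (fun l => s.A l ∪ {a | ∃ p ∈ g, p l = a}) ι A'
      -- New elements on the side `ι` need height at least `s.n + 1` even if both coordinates are
      -- old and low. New elements on the other side are already in the domain of `g`, so there the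
      -- plain maximum has to be used.
      h := fun l a => if a ∈ s.A l then s.h l a else
        if l = ι then max (max (t₁.h l a.1) (t₂.h l a.2)) (s.n + 1)
        else max (t₁.h l a.1) (t₂.h l a.2)
      g := g
      β := β
      n := s.n + 1 }
  have hsg : s.g ⊆ g := fun p hp => ⟨I.isState.dom_subset ι ⟨p, hp, rfl⟩,
    (I.isState.lt_of_dom ι _ ⟨p, hp, rfl⟩).trans (Nat.lt_succ_self _),
    h₁.isSuccessor.1.g_subset (I.g_fst p hp), h₂.isSuccessor.1.g_subset (I.g_snd p hp)⟩
  have hn₁ : t₁.n = s.n + 1 := by rw [h₁.isSuccessor.2, I.n_fst]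
  have hn₂ : t₂.n = s.n + 1 := by rw [h₂.isSuccessor.2, I.n_snd]
  have hAι : t.A ι = A' := by simp [t]
  have hAne : ∀ l, l ≠ ι → t.A l = s.A l ∪ t.dom l := fun l hl => by
    simp only [t, Function.update_of_ne hl]
    rfl
  have hsub : ∀ l, s.A l ⊆ t.A l := fun l => by
    rcases eq_or_ne l ι with rfl | hl
    · rwa [hAι]
    · rw [hAne l hl]
      exact Set.subset_union_left
  have hdsub : ∀ l, t.dom l ⊆ t.A l := fun l => by
    rcases eq_or_ne l ι with rfl | hl
    · rw [hAι]
      rintro _ ⟨p, hp, rfl⟩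
      exact hA hp.1
    · rw [hAne l hl]
      exact Set.subset_union_right
  have hd₁ : ∀ l, ∀ a ∈ t.dom l, a.1 ∈ t₁.dom l := by
    rintro l _ ⟨p, hp, rfl⟩
    exact ⟨_, hp.2.2.1, rfl⟩
  have hd₂ : ∀ l, ∀ a ∈ t.dom l, a.2 ∈ t₂.dom l := by
    rintro l _ ⟨p, hp, rfl⟩
    exact ⟨_, hp.2.2.2, rfl⟩
  have hA₁ : ∀ l, ∀ a ∈ t.A l, a.1 ∈ t₁.A l := fun l a ha => by
    rcases eq_or_ne l ι with rfl | hl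
    · rw [hAι] at ha
      rw [h₁.A_eq]
      exact Or.inr ⟨a, ha, rfl⟩
    · rw [hAne l hl] at ha
      rcases ha with ha | ha
      · exact h₁.isSuccessor.1.A_subset l (I.A_fst l a ha)
      · exact h₁.isState.dom_subset l (hd₁ l a ha)
  have hA₂ : ∀ l, ∀ a ∈ t.A l, a.2 ∈ t₂.A l := fun l a ha => by
    rcases eq_or_ne l ι with rfl | hl
    · rw [hAι] at ha
      rw [h₂.A_eq]
      exact Or.inr ⟨a, ha, rfl⟩
    · rw [hAne l hl] at ha
      rcases ha with ha | ha
      · exact h₂.isSuccessor.1.A_subset l (I.A_snd l a ha)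
      · exact h₂.isState.dom_subset l (hd₂ l a ha)
  have hold : ∀ l, ∀ a ∈ s.A l, t.h l a = s.h l a := fun l a ha => by simp [t, ha]
  have hold₁ : ∀ l, ∀ a ∈ s.A l, t₁.h l a.1 = s₁.h l a.1 := fun l a ha =>
    h₁.isSuccessor.1.h_eq l _ (I.A_fst l a ha)
  have hold₂ : ∀ l, ∀ a ∈ s.A l, t₂.h l a.2 = s₂.h l a.2 := fun l a ha =>
    h₂.isSuccessor.1.h_eq l _ (I.A_snd l a ha)
  have hle : ∀ l, ∀ a ∈ t.A l, t₁.h l a.1 ≤ t.h l a ∧ t₂.h l a.2 ≤ t.h l a ∧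
      t.h l a ≤ max (max (t₁.h l a.1) (t₂.h l a.2)) (s.n + 1) := fun l a _ => by
    by_cases ha : a ∈ s.A l
    · rw [hold l a ha, hold₁ l a ha, hold₂ l a ha]
      exact ⟨I.h_fst l a ha, I.h_snd l a ha,
        (I.h_le l a ha).trans (max_le_max le_rfl (Nat.le_succ _))⟩
    · by_cases hl : l = ι
      · simp [t, ha, hl]
      · simp only [t, ha, hl, if_false]
        exact ⟨le_max_left _ _, le_max_right _ _, le_max_left _ _⟩
  -- A matched element on the side opposite to `ι` may be old, with its height fixed earlier; this
  -- is the case that needs `I.h_le`.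
  have hlt : ∀ l, ∀ a ∈ t.dom l, t.h l a < s.n + 1 := fun l a had => by
    have e₁ := hn₁ ▸ h₁.isState.lt_of_dom l _ (hd₁ l a had)
    have e₂ := hn₂ ▸ h₂.isState.lt_of_dom l _ (hd₂ l a had)
    by_cases ha : a ∈ s.A l
    · have := I.h_le l a ha
      rw [← hold₁ l a ha, ← hold₂ l a ha] at this
      rw [hold l a ha]
      exact this.trans_lt (max_lt (max_lt e₁ e₂) (Nat.lt_succ_self _))
    · rcases eq_or_ne l ι with rfl | hl
      · obtain ⟨p, hp, rfl⟩ := had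
        exact absurd hp.1 ha
      · simp only [t, ha, hl, if_false]
        exact max_lt e₁ e₂
  have hstate : IsState (qf τ) θ α t := by
    refine ⟨fun l => ?_, hβ.le.trans I.isState.ordinal_le, ?_, hdsub, ?_, hlt⟩
    -- An element is determined by its coordinates, and `θ * θ = θ` for infinite `θ`.
    · let f : t.A l → t₁.A l × t₂.A l := fun a => (⟨a.1.1, hA₁ l a a.2⟩, ⟨a.1.2, hA₂ l a a.2⟩)
      have hf : Function.Injective f := fun a b hab => by
        have e := Prod.ext_iff.1 hab
        exact Subtype.ext (Prod.ext (congrArg Subtype.val e.1) (congrArg Subtype.val e.2))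
      calc #(t.A l) ≤ #(t₁.A l × t₂.A l) := mk_le_of_injective hf
        _ = #(t₁.A l) * #(t₂.A l) := by simp
        _ ≤ θ * θ := mul_le_mul' (h₁.isState.card_le l) (h₂.isState.card_le l)
        _ = θ := mul_eq_self hθ
    · intro l p hp q hq hpq
      have e₁ := h₁.isState.one_to_one l _ hp.2.2.1 _ hq.2.2.1 (congrArg Prod.fst hpq)
      have e₂ := h₂.isState.one_to_one l _ hp.2.2.2 _ hq.2.2.2 (congrArg Prod.snd hpq)
      exact funext fun k => Prod.ext (congrFun e₁ k) (congrFun e₂ k)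
    · exact preserves_qf_iff.2 (((preserves_qf_iff.1 h₁.isState.preserves).prod
        (preserves_qf_iff.1 h₂.isState.preserves)).mono fun p hp => hp.2.2)
  refine ⟨t, ⟨hstate, h₁.isState, h₂.isState, h₁.β_eq, h₂.β_eq, hn₁, hn₂, hA₁, hA₂,
      fun l a ha => (hle l a ha).1, fun l a ha => (hle l a ha).2.1, fun l a ha => (hle l a ha).2.2,
      fun p hp => hp.2.2.1, fun p hp => hp.2.2.2⟩,
    hstate, ⟨⟨hsub, hold, hsg, hβ, Nat.lt_succ_self _⟩, rfl⟩, hAι, hAne _ (by simp), ?_, ?_, rfl⟩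
  · rintro a ⟨_, ha⟩
    simp [t, ha]
  · ext a
    constructor
    · rintro ⟨p, hp, rfl⟩
      exact ⟨hp.1, hp.2.1⟩
    · rintro ⟨ha, hh⟩
      have m₁ : a.1 ∈ t₁.dom ι := by
        rw [h₁.dom_eq, I.n_fst]
        exact ⟨I.A_fst ι a ha, (I.h_fst ι a ha).trans_lt hh⟩
      have m₂ : a.2 ∈ t₂.dom ι := by
        rw [h₂.dom_eq, I.n_snd]
        exact ⟨I.A_snd ι a ha, (I.h_snd ι a ha).trans_lt hh⟩
      obtain ⟨p₁, hp₁, e₁⟩ := m₁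
      obtain ⟨p₂, hp₂, e₂⟩ := m₂
      have e : ((p₁ ι, p₂ ι) : prodModel (M ι) (N ι)) = a := Prod.ext e₁ e₂
      subst e
      exact ⟨fun l => (p₁ l, p₂ l), ⟨ha, hh, hp₁, hp₂⟩, rfl⟩

theorem isoWins_prod {θ : Cardinal.{u}} {α : Ordinal.{u}} {M N : Bool → Model τ} (hθ : ℵ₀ ≤ θ)
    (hM : IsoWins (qf τ) θ α M) (hN : IsoWins (qf τ) θ α N) :
    IsoWins (qf τ) θ α (fun l => prodModel (M l) (N l)) := by
  obtain ⟨i₁, W₁, m₁, hW₁⟩ := hM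
  obtain ⟨i₂, W₂, m₂, hW₂⟩ := hN
  have i : IsState (qf τ) θ α (initial (fun l => prodModel (M l) (N l)) α) :=
    isState_initial_iff.2 (((isState_initial_iff.1 i₁).prod (isState_initial_iff.1 i₂)).mono
      (Set.empty_subset _))
  refine ⟨i, {s | ∃ s₁ ∈ W₁, ∃ s₂ ∈ W₂, ProdInv θ α s s₁ s₂}, ⟨_, m₁, _, m₂, ?_⟩, ?_⟩
  · exact ⟨i, i₁, i₂, rfl, rfl, rfl, rfl, fun _ _ h => h.elim, fun _ _ h => h.elim,
      fun _ _ h => h.elim, fun _ _ h => h.elim, fun _ _ h => h.elim, fun _ h => h.elim,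
      fun _ h => h.elim⟩
  · rintro s ⟨s₁, hs₁, s₂, hs₂, I⟩ ⟨β, ι, A'⟩ ⟨hβ, hA, hc⟩
    -- The set `s₁.A ι` may exceed the projection of `s.A ι`: a factor can match a coordinate while
    -- the pair itself is still waiting. Hence the union in the simulated move.
    obtain ⟨t₁, ht₁, h₁⟩ := hW₁ s₁ hs₁ ⟨β, ι, s₁.A ι ∪ Prod.fst '' A'⟩
      ⟨I.β_fst ▸ hβ, Set.subset_union_left, (mk_union_le _ _).trans
        (add_le_of_le hθ (I.isState_fst.card_le ι) (mk_image_le.trans hc))⟩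
    obtain ⟨t₂, ht₂, h₂⟩ := hW₂ s₂ hs₂ ⟨β, ι, s₂.A ι ∪ Prod.snd '' A'⟩
      ⟨I.β_snd ▸ hβ, Set.subset_union_left, (mk_union_le _ _).trans
        (add_le_of_le hθ (I.isState_snd.card_le ι) (mk_image_le.trans hc))⟩
    obtain ⟨t, It, h⟩ := I.step hθ hβ hA h₁ h₂
    exact ⟨t, ⟨t₁, ht₁, t₂, ht₂, It⟩, h⟩

/-! ### Sums -/

section Sum

variable (hτ : OnlyUnaryFunctions τ) {M N : Bool → Model τ}

/-- The disjoint union of two sets of pairs. -/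
def sumPairs (g₁ : Set (∀ l, M l)) (g₂ : Set (∀ l, N l)) : Set (∀ l, sumModel hτ (M l) (N l)) :=
  {p | (∃ q ∈ g₁, p = fun l => Sum.inl (q l)) ∨ ∃ q ∈ g₂, p = fun l => Sum.inr (q l)}

/-- Both ends of a pair lie in the same summand, so a tuple is left on one side exactly when it is
left on the other. Lifting the witness to a tuple of pairs makes all but `P` independent of `l`. -/
theorem exists_inl_comp_iff {g₁ : Set (∀ l, M l)} {g₂ : Set (∀ l, N l)} {n : ℕ}
    {x : Fin n → ∀ l, sumModel hτ (M l) (N l)} (hx : ∀ i, x i ∈ sumPairs hτ g₁ g₂) (l : Bool)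
    (P : (Fin n → M l) → Prop) :
    (∃ y, (fun i => x i l) = Sum.inl ∘ y ∧ P y) ↔
      ∃ z : Fin n → ∀ l, M l, (∀ i, z i ∈ g₁) ∧ (∀ i, x i = fun l => Sum.inl (z i l)) ∧
        P fun i => z i l := by
  constructor
  · rintro ⟨y, hy, hP⟩
    have : ∀ i, ∃ q ∈ g₁, x i = fun l => Sum.inl (q l) := fun i => by
      rcases hx i with h | ⟨q, _, h⟩
      · exact h
      · have e := congrFun hy i
        simp only [h] at e
        exact nomatch e
    choose z hz hxz using this
    refine ⟨z, hz, hxz, ?_⟩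
    convert hP using 1
    funext i
    have e := congrFun hy i
    simp only [hxz] at e
    exact Sum.inl_injective e
  · rintro ⟨z, _, hxz, hP⟩
    exact ⟨_, funext fun i => by rw [hxz i]; rfl, hP⟩

theorem exists_inr_comp_iff {g₁ : Set (∀ l, M l)} {g₂ : Set (∀ l, N l)} {n : ℕ}
    {x : Fin n → ∀ l, sumModel hτ (M l) (N l)} (hx : ∀ i, x i ∈ sumPairs hτ g₁ g₂) (l : Bool)
    (P : (Fin n → N l) → Prop) :
    (∃ y, (fun i => x i l) = Sum.inr ∘ y ∧ P y) ↔
      ∃ z : Fin n → ∀ l, N l, (∀ i, z i ∈ g₂) ∧ (∀ i, x i = fun l => Sum.inr (z i l)) ∧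
        P fun i => z i l := by
  constructor
  · rintro ⟨y, hy, hP⟩
    have : ∀ i, ∃ q ∈ g₂, x i = fun l => Sum.inr (q l) := fun i => by
      rcases hx i with ⟨q, _, h⟩ | h
      · have e := congrFun hy i
        simp only [h] at e
        exact nomatch e
      · exact h
    choose z hz hxz using this
    refine ⟨z, hz, hxz, ?_⟩
    convert hP using 1
    funext i
    have e := congrFun hy i
    simp only [hxz] at e
    exact Sum.inr_injective e
  · rintro ⟨z, _, hxz, hP⟩
    exact ⟨_, funext fun i => by rw [hxz i]; rfl, hP⟩

/-- The two disjuncts for a relation are compared separately, since for a 0-place predicate the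
empty tuple belongs to both summands. Equations with a unary function can hold only within one
summand. -/
theorem PreservesAtomic.sum {g₁ : Set (∀ l, M l)} {g₂ : Set (∀ l, N l)}
    (h₁ : PreservesAtomic g₁) (h₂ : PreservesAtomic g₂) :
    PreservesAtomic (sumPairs hτ g₁ g₂) where
  rel R x hx := by
    refine or_congr
      ((exists_inl_comp_iff hτ hx false _).trans (Iff.trans ?_ (exists_inl_comp_iff hτ hx true _).symm))
      ((exists_inr_comp_iff hτ hx false _).trans (Iff.trans ?_ (exists_inr_comp_iff hτ hx true _).symm))
    · exact exists_congr fun z => and_congr_right fun hz => and_congr_right fun _ => h₁.rel R z hz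
    · exact exists_congr fun z => and_congr_right fun hz => and_congr_right fun _ => h₂.rel R z hz
  eq := by
    rintro _ (⟨p, hp, rfl⟩ | ⟨p, hp, rfl⟩) _ (⟨q, hq, rfl⟩ | ⟨q, hq, rfl⟩)
    · exact Sum.inl_injective.eq_iff.trans ((h₁.eq p hp q hq).trans Sum.inl_injective.eq_iff.symm)
    · exact iff_of_false Sum.inl_ne_inr Sum.inl_ne_inr
    · exact iff_of_false Sum.inr_ne_inl Sum.inr_ne_inl
    · exact Sum.inr_injective.eq_iff.trans ((h₂.eq p hp q hq).trans Sum.inr_injective.eq_iff.symm)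
  func {n} F p x hp hx := by
    obtain rfl : n = 1 := by
      by_contra hn
      exact (hτ n hn).false F
    change (p false = Sum.map (fun a : M false => Structure.funMap F fun _ => a)
        (fun b : N false => Structure.funMap F fun _ => b) (x 0 false)) ↔
      (p true = Sum.map (fun a : M true => Structure.funMap F fun _ => a)
        (fun b : N true => Structure.funMap F fun _ => b) (x 0 true))
    rcases hp with ⟨p, hp, rfl⟩ | ⟨p, hp, rfl⟩ <;> rcases hx 0 with ⟨q, hq, h⟩ | ⟨q, hq, h⟩ <;>
      rw [h]
    · exact Sum.inl_injective.eq_iff.trans ((h₁.func F p (fun _ => q) hp fun _ => hq).trans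
        Sum.inl_injective.eq_iff.symm)
    · exact iff_of_false Sum.inl_ne_inr Sum.inl_ne_inr
    · exact iff_of_false Sum.inr_ne_inl Sum.inr_ne_inl
    · exact Sum.inr_injective.eq_iff.trans ((h₂.func F p (fun _ => q) hp fun _ => hq).trans
        Sum.inr_injective.eq_iff.symm)

/-- The disjoint union of two positions, with the ordinal and the counter of the first one. -/
def sumPosition (s₁ : Position M) (s₂ : Position N) :
    Position fun l => sumModel hτ (M l) (N l) where
  A l := (Sum.inl '' s₁.A l ∪ Sum.inr '' s₂.A l : Set (M l ⊕ N l))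
  h l := Sum.elim (s₁.h l) (s₂.h l)
  g := sumPairs hτ s₁.g s₂.g
  β := s₁.β
  n := s₁.n

theorem dom_sumPosition (s₁ : Position M) (s₂ : Position N) (l : Bool) :
    (sumPosition hτ s₁ s₂).dom l =
      (Sum.inl '' s₁.dom l ∪ Sum.inr '' s₂.dom l : Set (M l ⊕ N l)) := by
  apply Set.Subset.antisymm
  · rintro _ ⟨_, ⟨q, hq, rfl⟩ | ⟨q, hq, rfl⟩, rfl⟩
    · exact Or.inl ⟨_, ⟨q, hq, rfl⟩, rfl⟩
    · exact Or.inr ⟨_, ⟨q, hq, rfl⟩, rfl⟩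
  · rintro _ (⟨_, ⟨q, hq, rfl⟩, rfl⟩ | ⟨_, ⟨q, hq, rfl⟩, rfl⟩)
    · exact ⟨_, Or.inl ⟨q, hq, rfl⟩, rfl⟩
    · exact ⟨_, Or.inr ⟨q, hq, rfl⟩, rfl⟩

theorem sumPosition_initial (α : Ordinal.{u}) :
    sumPosition hτ (initial M α) (initial N α) =
      initial (fun l => sumModel hτ (M l) (N l)) α := by
  have hA : (fun l => (Sum.inl '' (∅ : Set (M l)) ∪ Sum.inr '' (∅ : Set (N l)) :
      Set (M l ⊕ N l))) = fun _ => ∅ := by simp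
  have hh : (fun l => Sum.elim (fun _ : M l => 0) (fun _ : N l => 0)) =
      fun l (_ : M l ⊕ N l) => (0 : ℕ) := by
    funext l a
    cases a <;> rfl
  have hg : sumPairs hτ (∅ : Set (∀ l, M l)) (∅ : Set (∀ l, N l)) = ∅ := by
    simp [sumPairs]
  unfold sumPosition initial
  congr

theorem isState_sumPosition {θ : Cardinal.{u}} {α : Ordinal.{u}} (hθ : ℵ₀ ≤ θ)
    {s₁ : Position M} {s₂ : Position N} (hn : s₁.n = s₂.n)
    (h₁ : IsState (qf τ) θ α s₁) (h₂ : IsState (qf τ) θ α s₂) :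
    IsState (qf τ) θ α (sumPosition hτ s₁ s₂) where
  card_le l := (mk_union_le _ _).trans
    (add_le_of_le hθ (mk_image_le.trans (h₁.card_le l)) (mk_image_le.trans (h₂.card_le l)))
  ordinal_le := h₁.ordinal_le
  one_to_one := by
    rintro l _ (⟨p, hp, rfl⟩ | ⟨p, hp, rfl⟩) _ (⟨q, hq, rfl⟩ | ⟨q, hq, rfl⟩) h
    · rw [h₁.one_to_one l p hp q hq (Sum.inl_injective h)]
    · exact (Sum.inl_ne_inr h).elim
    · exact (Sum.inr_ne_inl h).elim
    · rw [h₂.one_to_one l p hp q hq (Sum.inr_injective h)]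
  dom_subset l := by
    rw [dom_sumPosition]
    exact Set.union_subset_union (Set.image_mono (h₁.dom_subset l))
      (Set.image_mono (h₂.dom_subset l))
  preserves := preserves_qf_iff.2
    ((preserves_qf_iff.1 h₁.preserves).sum hτ (preserves_qf_iff.1 h₂.preserves))
  lt_of_dom l := by
    rw [dom_sumPosition]
    rintro _ (⟨a, ha, rfl⟩ | ⟨a, ha, rfl⟩)
    · exact h₁.lt_of_dom l a ha
    · exact (h₂.lt_of_dom l a ha).trans_eq hn.symm

/-- A move of AIS splits into its traces on the summands, and each rule is checked on each summand;
only the ordinal and the counter are shared. -/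
theorem isoLegal_sumPosition {θ : Cardinal.{u}} {α : Ordinal.{u}} (hθ : ℵ₀ ≤ θ)
    {s₁ t₁ : Position M} {s₂ t₂ : Position N} (hn : s₁.n = s₂.n)
    {β : Ordinal.{u}} {ι : Bool} {A' : Set (M ι ⊕ N ι)}
    (h₁ : IsoLegal (qf τ) θ α s₁ ⟨β, ι, Sum.inl ⁻¹' A'⟩ t₁)
    (h₂ : IsoLegal (qf τ) θ α s₂ ⟨β, ι, Sum.inr ⁻¹' A'⟩ t₂) :
    IsoLegal (qf τ) θ α (sumPosition hτ s₁ s₂) ⟨β, ι, A'⟩ (sumPosition hτ t₁ t₂) where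
  isState := isState_sumPosition hτ hθ
    (by rw [h₁.isSuccessor.2, h₂.isSuccessor.2, hn]) h₁.isState h₂.isState
  isSuccessor := by
    obtain ⟨e₁, f₁⟩ := h₁.isSuccessor
    obtain ⟨e₂, f₂⟩ := h₂.isSuccessor
    refine ⟨⟨fun l => Set.union_subset_union (Set.image_mono (e₁.A_subset l))
      (Set.image_mono (e₂.A_subset l)), ?_, ?_, e₁.β_lt, e₁.n_lt⟩, f₁⟩
    · rintro l _ (⟨a, ha, rfl⟩ | ⟨a, ha, rfl⟩)
      · exact e₁.h_eq l a ha
      · exact e₂.h_eq l a ha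
    · rintro _ (⟨q, hq, rfl⟩ | ⟨q, hq, rfl⟩)
      · exact Or.inl ⟨q, e₁.g_subset hq, rfl⟩
      · exact Or.inr ⟨q, e₂.g_subset hq, rfl⟩
  A_eq := by
    change Sum.inl '' t₁.A ι ∪ Sum.inr '' t₂.A ι = A'
    rw [h₁.A_eq, h₂.A_eq]
    exact Set.image_preimage_inl_union_image_preimage_inr A'
  A_other := by
    rw [dom_sumPosition]
    change Sum.inl '' t₁.A (!ι) ∪ Sum.inr '' t₂.A (!ι) =
      (Sum.inl '' s₁.A (!ι) ∪ Sum.inr '' s₂.A (!ι)) ∪ (Sum.inl '' t₁.dom (!ι) ∪ Sum.inr '' t₂.dom (!ι))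
    rw [h₁.A_other, h₂.A_other, Set.image_union, Set.image_union, Set.union_union_union_comm]
  le_h := by
    rintro (a | a) ⟨ha, hs⟩
    · exact h₁.le_h a ⟨ha, fun h => hs (Or.inl ⟨a, h, rfl⟩)⟩
    · exact (congrArg (· + 1) hn).trans_le (h₂.le_h a ⟨ha, fun h => hs (Or.inr ⟨a, h, rfl⟩)⟩)
  dom_eq := by
    rw [dom_sumPosition, h₁.dom_eq, h₂.dom_eq, ← hn]
    apply Set.Subset.antisymm
    · rintro _ (⟨a, ⟨ha, hh⟩, rfl⟩ | ⟨a, ⟨ha, hh⟩, rfl⟩)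
      · exact ⟨Or.inl ⟨a, ha, rfl⟩, hh⟩
      · exact ⟨Or.inr ⟨a, ha, rfl⟩, hh⟩
    · rintro _ ⟨⟨a, ha, rfl⟩ | ⟨a, ha, rfl⟩, hh⟩
      · exact Or.inl ⟨a, ⟨ha, hh⟩, rfl⟩
      · exact Or.inr ⟨a, ⟨ha, hh⟩, rfl⟩
  β_eq := h₁.β_eq

theorem isoWins_sum {θ : Cardinal.{u}} {α : Ordinal.{u}} (hθ : ℵ₀ ≤ θ)
    (hM : IsoWins (qf τ) θ α M) (hN : IsoWins (qf τ) θ α N) :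
    IsoWins (qf τ) θ α (fun l => sumModel hτ (M l) (N l)) := by
  obtain ⟨i₁, W₁, m₁, hW₁⟩ := hM
  obtain ⟨i₂, W₂, m₂, hW₂⟩ := hN
  refine ⟨sumPosition_initial hτ α ▸ isState_sumPosition hτ hθ rfl i₁ i₂,
    {s | ∃ s₁ ∈ W₁, ∃ s₂ ∈ W₂, s₁.β = s₂.β ∧ s₁.n = s₂.n ∧ sumPosition hτ s₁ s₂ = s},
    ⟨_, m₁, _, m₂, rfl, rfl, sumPosition_initial hτ α⟩, ?_⟩
  rintro _ ⟨s₁, hs₁, s₂, hs₂, hβ, hn, rfl⟩ ⟨β, ι, A'⟩ ⟨hlt, hA, hc⟩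
  obtain ⟨t₁, ht₁, h₁⟩ := hW₁ s₁ hs₁ ⟨β, ι, Sum.inl ⁻¹' A'⟩
    ⟨hlt, fun a ha => hA (Or.inl ⟨a, ha, rfl⟩),
      (mk_preimage_of_injective _ _ Sum.inl_injective).trans hc⟩
  obtain ⟨t₂, ht₂, h₂⟩ := hW₂ s₂ hs₂ ⟨β, ι, Sum.inr ⁻¹' A'⟩
    ⟨hβ ▸ hlt, fun a ha => hA (Or.inr ⟨a, ha, rfl⟩),
      (mk_preimage_of_injective _ _ Sum.inr_injective).trans hc⟩
  exact ⟨_, ⟨t₁, ht₁, t₂, ht₂, h₁.β_eq.trans h₂.β_eq.symm,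
    by rw [h₁.isSuccessor.2, h₂.isSuccessor.2, hn], rfl⟩, isoLegal_sumPosition hτ hθ hn h₁ h₂⟩

end Sum

/-! ### Congruence of the equivalence relations -/

theorem exists_eq_natCast_of_lt_succ_ord {θ : Cardinal.{u}} {α : Ordinal.{u}} (hθ : θ < ℵ₀)
    (hα : α < (Order.succ θ).ord) : ∃ k : ℕ, α = k := by
  obtain ⟨n, rfl⟩ := lt_aleph0.1 hθ
  rw [succ_natCast, ← Nat.cast_succ, ord_natCast] at hα
  exact Ordinal.lt_omega0.1 (hα.trans (Ordinal.natCast_lt_omega0 _))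

theorem E0_prod {θ : Cardinal.{u}} {α : Ordinal.{u}} (hα : α < (Order.succ θ).ord)
    {M₁ M₂ N₁ N₂ : Model τ} (h₁ : E0 (qf τ) θ α M₁ N₁) (h₂ : E0 (qf τ) θ α M₂ N₂) :
    E0 (qf τ) θ α (prodModel M₁ M₂) (prodModel N₁ N₂) := by
  rw [E0_iff_isoWins] at *
  have e : pair (prodModel M₁ M₂) (prodModel N₁ N₂) =
      fun l => prodModel (pair M₁ N₁ l) (pair M₂ N₂ l) := by
    funext l
    cases l <;> rfl
  rw [e]
  rcases le_or_gt ℵ₀ θ with hθ | hθ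
  · exact isoWins_prod hθ h₁ h₂
  · obtain ⟨k, rfl⟩ := exists_eq_natCast_of_lt_succ_ord hθ hα
    exact isoWins_of_finite k (((isState_initial_iff.1 h₁.1).prod
      (isState_initial_iff.1 h₂.1)).mono (Set.empty_subset _))

theorem E0_sum {θ : Cardinal.{u}} {α : Ordinal.{u}} (hα : α < (Order.succ θ).ord)
    (hτ : OnlyUnaryFunctions τ) {M₁ M₂ N₁ N₂ : Model τ}
    (h₁ : E0 (qf τ) θ α M₁ N₁) (h₂ : E0 (qf τ) θ α M₂ N₂) :
    E0 (qf τ) θ α (sumModel hτ M₁ M₂) (sumModel hτ N₁ N₂) := by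
  rw [E0_iff_isoWins] at *
  have e : pair (sumModel hτ M₁ M₂) (sumModel hτ N₁ N₂) =
      fun l => sumModel hτ (pair M₁ N₁ l) (pair M₂ N₂ l) := by
    funext l
    cases l <;> rfl
  rw [e]
  rcases le_or_gt ℵ₀ θ with hθ | hθ
  · exact isoWins_sum hτ hθ h₁ h₂
  · obtain ⟨k, rfl⟩ := exists_eq_natCast_of_lt_succ_ord hθ hα
    exact isoWins_of_finite k (((isState_initial_iff.1 h₁.1).sum hτ
      (isState_initial_iff.1 h₂.1)).mono (Set.empty_subset _))

/-- ISO copies with a delay of one move: `g` is the identity on what the side `ι` contained before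
the move. As all heights stay at most the counter, this is exactly the prescribed domain. -/
theorem isoWins_refl {θ : Cardinal.{u}} {α : Ordinal.{u}} (hθ : ℵ₀ ≤ θ) (M : Model τ) :
    IsoWins (qf τ) θ α fun _ => M := by
  have hp : PreservesAtomic (M := fun _ => M) {p | p false = p true} :=
    ⟨fun R x hx => by simp only [show ∀ i, x i false = x i true from hx],
      fun p hp q hq => by rw [show p false = p true from hp, show q false = q true from hq],
      fun F p x hp hx => by
        simp only [show p false = p true from hp, show ∀ i, x i false = x i true from hx]⟩
  have i : IsState (qf τ) θ α (initial (fun _ => M) α) :=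
    isState_initial_iff.2 (hp.mono (Set.empty_subset _))
  refine ⟨i, {s | IsState (qf τ) θ α s ∧ (∀ p ∈ s.g, p false = p true) ∧
    ∀ l, ∀ a ∈ s.A l, s.h l a ≤ s.n}, ⟨i, fun _ h => h.elim, fun _ _ h => h.elim⟩, ?_⟩
  rintro s ⟨hs, hg, hh⟩ ⟨β, ι, A'⟩ ⟨hβ, hA, hc⟩
  dsimp only at hβ hA hc
  classical
  let t : Position fun _ : Bool => M :=
    { A := fun l => if l = ι then A' else s.A l ∪ s.A ι
      -- Fresh elements of AIS get the least height allowed; their copies enter the domain at once,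
      -- so height `0` is safe.
      h := fun l a => if a ∈ s.A l then s.h l a else if l = ι then s.n + 1 else 0
      g := {p | p false = p true ∧ p ι ∈ s.A ι}
      β := β
      n := s.n + 1 }
  have hconst : ∀ p ∈ t.g, ∀ l k, p l = p k := by
    rintro p ⟨hp, _⟩ (_ | _) (_ | _)
    exacts [rfl, hp, hp.symm, rfl]
  have hdom : ∀ l, t.dom l = s.A ι := fun l => by
    apply Set.Subset.antisymm
    · rintro _ ⟨p, hp, rfl⟩
      rw [hconst p hp l ι]
      exact hp.2
    · exact fun a ha => ⟨fun _ => a, ⟨rfl, ha⟩, rfl⟩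
  have hsub : ∀ l, s.A l ⊆ t.A l := fun l => by
    by_cases hl : l = ι
    · subst hl
      simpa [t] using hA
    · simp [t, hl]
  have ht : IsState (qf τ) θ α t := by
    refine ⟨fun l => ?_, hβ.le.trans hs.ordinal_le, ?_, fun l => ?_,
      preserves_qf_iff.2 (hp.mono fun p h => h.1), fun l a ha => ?_⟩
    · by_cases hl : l = ι
      · simpa [t, hl] using hc
      · simp only [t, hl, if_false]
        exact (mk_union_le _ _).trans (add_le_of_le hθ (hs.card_le l) (hs.card_le ι))
    · intro l p hp q hq h
      funext k
      rw [hconst p hp k l, h, hconst q hq l k]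
    · rw [hdom]
      by_cases hl : l = ι
      · simpa [t, hl] using hA
      · simp [t, hl]
    · rw [hdom] at ha
      change t.h l a < s.n + 1
      by_cases hal : a ∈ s.A l
      · simpa [t, hal] using Nat.lt_succ_of_le (hh l a hal)
      · have hl : l ≠ ι := by
          rintro rfl
          exact hal ha
        simp [t, hal, hl]
  refine ⟨t, ⟨ht, fun p h => h.1, fun l a _ => ?_⟩, ht,
    ⟨⟨hsub, fun l a ha => by simp [t, ha], fun p hp => ⟨hg p hp, hs.dom_subset ι ⟨p, hp, rfl⟩⟩, hβ,
      Nat.lt_succ_self _⟩, rfl⟩, by simp [t], ?_, ?_, ?_, rfl⟩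
  · change t.h l a ≤ s.n + 1
    by_cases ha : a ∈ s.A l
    · simpa [t, ha] using (hh l a ha).trans (Nat.le_succ _)
    · simp only [t, ha, if_false]
      split <;> simp
  · rw [hdom]
    simp [t]
  · rintro a ⟨_, ha⟩
    simp [t, ha]
  · rw [hdom]
    exact Set.ext fun a => ⟨fun ha => ⟨ha, Nat.lt_succ_of_le (hh ι a ha)⟩, fun ha => ha.1⟩

theorem E0_refl {θ : Cardinal.{u}} {α : Ordinal.{u}} (hα : α < (Order.succ θ).ord)
    (M : Model τ) : E0 (qf τ) θ α M M := by
  have e : pair M M = fun _ => M := by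
    funext l
    cases l <;> rfl
  rw [E0_iff_isoWins, e]
  rcases le_or_gt ℵ₀ θ with hθ | hθ
  · exact isoWins_refl hθ M
  · obtain ⟨k, rfl⟩ := exists_eq_natCast_of_lt_succ_ord hθ hα
    -- Only agreement of a model with itself on 0-place predicates is wanted; it is read off the
    -- game at `ℵ₀`.
    exact isoWins_of_finite k (isState_initial_iff.1 (isoWins_refl (α := 0) le_rfl M).1)

/-- A binary operation compatible with a reflexive relation is compatible with the equivalence
relation that it generates. -/
theorem eqvGen_congr₂ {X : Type*} {r : X → X → Prop} (hr : ∀ x, r x x) {f : X → X → X}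
    (hf : ∀ {x x' y y'}, r x x' → r y y' → r (f x y) (f x' y')) {x x' y y' : X}
    (hx : Relation.EqvGen r x x') (hy : Relation.EqvGen r y y') :
    Relation.EqvGen r (f x y) (f x' y') := by
  -- Chains in the two arguments need not match in length or direction, so one argument moves at a
  -- time; reflexivity supplies the step in the fixed one.
  have left : ∀ {x x'} (y), Relation.EqvGen r x x' → Relation.EqvGen r (f x y) (f x' y) := by
    intro x x' y h
    induction h with
    | rel _ _ h => exact .rel _ _ (hf h (hr y))
    | refl => exact .refl _
    | symm _ _ _ ih => exact ih.symm
    | trans _ _ _ _ _ ih₁ ih₂ => exact ih₁.trans _ _ _ ih₂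
  have right : ∀ {y y'} (x), Relation.EqvGen r y y' → Relation.EqvGen r (f x y) (f x y') := by
    intro y y' x h
    induction h with
    | rel _ _ h => exact .rel _ _ (hf (hr x) h)
    | refl => exact .refl _
    | symm _ _ _ ih => exact ih.symm
    | trans _ _ _ _ _ ih₁ ih₂ => exact ih₁.trans _ _ _ ih₂
  exact (left y hx).trans _ _ _ (right x' hy)

theorem E1_prod {θ : Cardinal.{u}} {α : Ordinal.{u}} (hα : α < (Order.succ θ).ord)
    {M₁ M₂ N₁ N₂ : Model τ} (h₁ : E1 (qf τ) θ α M₁ N₁) (h₂ : E1 (qf τ) θ α M₂ N₂) :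
    E1 (qf τ) θ α (prodModel M₁ M₂) (prodModel N₁ N₂) :=
  eqvGen_congr₂ (E0_refl hα) (E0_prod hα) h₁ h₂

theorem E1_sum {θ : Cardinal.{u}} {α : Ordinal.{u}} (hα : α < (Order.succ θ).ord)
    (hτ : OnlyUnaryFunctions τ) {M₁ M₂ N₁ N₂ : Model τ}
    (h₁ : E1 (qf τ) θ α M₁ N₁) (h₂ : E1 (qf τ) θ α M₂ N₂) :
    E1 (qf τ) θ α (sumModel hτ M₁ M₂) (sumModel hτ N₁ N₂) :=
  eqvGen_congr₂ (E0_refl hα) (E0_sum hα hτ) h₁ h₂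

/-! ### Theories -/

theorem OnlyUnaryFunctions.toLanguage (hτ : OnlyUnaryFunctions τ) (σ : SubVocabulary τ) :
    OnlyUnaryFunctions σ.toLanguage :=
  fun n hn => ⟨fun f => (hτ n hn).false f.1⟩

theorem reduct_prodModel (M₁ M₂ : Model τ) (σ : SubVocabulary τ) :
    reduct (prodModel M₁ M₂) σ = prodModel (reduct M₁ σ) (reduct M₂ σ) :=
  rfl

theorem reduct_sumModel (hτ : OnlyUnaryFunctions τ) (M₁ M₂ : Model τ) (σ : SubVocabulary τ) :
    reduct (sumModel hτ M₁ M₂) σ = sumModel (hτ.toLanguage σ) (reduct M₁ σ) (reduct M₂ σ) :=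
  rfl

theorem one_le_bethOver_add_one (θ : Cardinal.{u}) (α : Ordinal.{u}) :
    1 ≤ bethOver θ (α + 1) := by
  rw [bethOver, Ordinal.limitRecOn_add_one, Cardinal.one_le_iff_ne_zero]
  exact power_ne_zero _ two_ne_zero

/-- Two models have the same `𝕃¹_κ`-theory iff all their small reducts are equivalent. -/
theorem Th_eq_iff {κ : Cardinal.{u}} {M N : Model τ} :
    Th κ M = Th κ N ↔ ∀ θ < κ, ∀ σ : SubVocabulary τ, σ.toLanguage.card ≤ θ →
      ∀ α < (Order.succ θ).ord, E1 (qf σ.toLanguage) θ α (reduct M σ) (reduct N σ) := by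
  constructor
  · intro h θ hθ σ hσ α hα
    -- The sentence listing only `reduct N σ` defines its `E1`-class; it holds in `N`, hence in `M`.
    let ψ : SentenceLE τ θ :=
      ⟨σ, hσ, α, hα, PUnit, by simpa using one_le_bethOver_add_one θ α, fun _ => reduct N σ⟩
    have hN : (⟨⟨θ, hθ⟩, ψ⟩ : SentenceK κ τ) ∈ Th κ N := ⟨⟨⟩, (E1 _ _ _).refl _⟩
    rw [← h] at hN
    obtain ⟨_, hi⟩ := hN
    exact hi
  · intro h
    ext ⟨θ, ψ⟩
    have e := h θ.1 θ.2 ψ.τ₁ ψ.card_le ψ.α ψ.α_lt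
    exact exists_congr fun i => 
      ⟨fun hi => (E1 _ _ _).trans ((E1 _ _ _).symm e) hi, fun hi => (E1 _ _ _).trans e hi⟩

/-- An operation is a function of an invariant as soon as it respects it. -/
theorem exists_op_of_congr {X Y : Type*} [Nonempty Y] {T : X → Y} {f : X → X → X}
    (hf : ∀ x y x' y', T x = T x' → T y = T y' → T (f x y) = T (f x' y')) :
    ∃ op : Y → Y → Y, ∀ x y, T (f x y) = op (T x) (T y) := by
  classical
  -- Values outside the range of `T` are irrelevant; inside it, chosen representatives serve by
  -- `hf`.
  refine ⟨fun a b => if h : ∃ p : X × X, T p.1 = a ∧ T p.2 = b then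
    T (f h.choose.1 h.choose.2) else Classical.arbitrary Y, fun x y => ?_⟩
  have h : ∃ p : X × X, T p.1 = T x ∧ T p.2 = T y := ⟨(x, y), rfl, rfl⟩
  dsimp only
  rw [dif_pos h]
  exact hf _ _ _ _ h.choose_spec.1.symm h.choose_spec.2.symm

theorem Th_prod_congr {κ : Cardinal.{u}} (M₁ M₂ N₁ N₂ : Model τ) (h₁ : Th κ M₁ = Th κ N₁)
    (h₂ : Th κ M₂ = Th κ N₂) : Th κ (prodModel M₁ M₂) = Th κ (prodModel N₁ N₂) := by
  rw [Th_eq_iff] at *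
  intro θ hθ σ hσ α hα
  rw [reduct_prodModel, reduct_prodModel]
  exact E1_prod hα (h₁ θ hθ σ hσ α hα) (h₂ θ hθ σ hσ α hα)

theorem Th_sum_congr {κ : Cardinal.{u}} (hτ : OnlyUnaryFunctions τ) (M₁ M₂ N₁ N₂ : Model τ)
    (h₁ : Th κ M₁ = Th κ N₁) (h₂ : Th κ M₂ = Th κ N₂) :
    Th κ (sumModel hτ M₁ M₂) = Th κ (sumModel hτ N₁ N₂) := by
  rw [Th_eq_iff] at *
  intro θ hθ σ hσ α hα
  rw [reduct_sumModel, reduct_sumModel]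
  exact E1_sum hα (hτ.toLanguage σ) (h₁ θ hθ σ hσ α hα) (h₂ θ hθ σ hσ α hα)

end ShelahL1

end

open ShelahL1

theorem theorem3p11 (κ : Cardinal.{u}) (hκ : κ = Cardinal.beth κ.ord)
    (τ : FirstOrder.Language.{u, u}) :
    -- sums
    (∀ hτ : OnlyUnaryFunctions τ,
      (∃ add : Set (SentenceK κ τ) → Set (SentenceK κ τ) → Set (SentenceK κ τ),
        ∀ M₁ M₂ : Model τ, Th κ (sumModel hτ M₁ M₂) = add (Th κ M₁) (Th κ M₂)) ∧
      (∀ M₁ M₂ N₁ N₂ : Model τ, Th κ M₁ = Th κ N₁ → Th κ M₂ = Th κ N₂ →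
        Th κ (sumModel hτ M₁ M₂) = Th κ (sumModel hτ N₁ N₂)) ∧
      (∀ (θ : Cardinal.{u}) (α : Ordinal.{u}), θ < κ → α < (Order.succ θ).ord →
        (∃ add : Quotient (E1 (qf τ) θ α) → Quotient (E1 (qf τ) θ α) → Quotient (E1 (qf τ) θ α),
          ∀ M₁ M₂ : Model τ,
            classE1 θ α (sumModel hτ M₁ M₂) = add (classE1 θ α M₁) (classE1 θ α M₂)) ∧
        (∀ M₁ M₂ N₁ N₂ : Model τ, E1 (qf τ) θ α M₁ N₁ → E1 (qf τ) θ α M₂ N₂ →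
          E1 (qf τ) θ α (sumModel hτ M₁ M₂) (sumModel hτ N₁ N₂)))) ∧
    -- products
    ((∃ mul : Set (SentenceK κ τ) → Set (SentenceK κ τ) → Set (SentenceK κ τ),
        ∀ M₁ M₂ : Model τ, Th κ (prodModel M₁ M₂) = mul (Th κ M₁) (Th κ M₂)) ∧
      (∀ M₁ M₂ N₁ N₂ : Model τ, Th κ M₁ = Th κ N₁ → Th κ M₂ = Th κ N₂ →
        Th κ (prodModel M₁ M₂) = Th κ (prodModel N₁ N₂)) ∧
      (∀ (θ : Cardinal.{u}) (α : Ordinal.{u}), θ < κ → α < (Order.succ θ).ord →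
        (∃ mul : Quotient (E1 (qf τ) θ α) → Quotient (E1 (qf τ) θ α) → Quotient (E1 (qf τ) θ α),
          ∀ M₁ M₂ : Model τ,
            classE1 θ α (prodModel M₁ M₂) = mul (classE1 θ α M₁) (classE1 θ α M₂)) ∧
        (∀ M₁ M₂ N₁ N₂ : Model τ, E1 (qf τ) θ α M₁ N₁ → E1 (qf τ) θ α M₂ N₂ →
          E1 (qf τ) θ α (prodModel M₁ M₂) (prodModel N₁ N₂)))) := by
  refine ⟨fun hτ => ⟨exists_op_of_congr fun _ _ _ _ => Th_sum_congr hτ _ _ _ _, Th_sum_congr hτ,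
      fun θ α _ hα => ⟨⟨Quotient.map₂ (sumModel hτ) fun _ _ h₁ _ _ h₂ => E1_sum hα hτ h₁ h₂,
        fun _ _ => rfl⟩, fun _ _ _ _ => E1_sum hα hτ⟩⟩,
    exists_op_of_congr fun _ _ _ _ => Th_prod_congr _ _ _ _, Th_prod_congr,
    fun θ α _ hα => ⟨⟨Quotient.map₂ prodModel fun _ _ h₁ _ _ h₂ => E1_prod hα h₁ h₂,
      fun _ _ => rfl⟩, fun _ _ _ _ => E1_prod hα⟩⟩
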